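/- Let $\Omega\subset\mathbb R^d$ be compact, let $\mu$ be a Borel probability measure on $\Omega$, let $1<p<\infty$, and let $L_p=L_p(\Omega,\mu)$ be the real $L_p$ space with norm $\|\cdot\|_p$. Let $\Psi=\{\psi_k\}_{k=1}^\infty$ be a Schauder basis of $L_p$ with $0<c_0\le\|\psi_k\|_p\le1$ for all $k$, and write $f=\sum_k c_k(f)\psi_k$. For $f\in L_p$ let $D(f)$ be the set of injective sequences $\varrho=(k_j)_{j\ge1}$ of positive integers which contain every $k$ with $c_k(f)\ne0$ and satisfy $|c_{k_1}(f)|\ge|c_{k_2}(f)|\ge\cdots$, and put $G_m(f,\Psi,\varrho)=\sum_{j=1}^m c_{k_j}(f)\psi_{k_j}$. Suppose that $\Psi$ is quasi-greedy, i.e. there is a constant $K$ with $\|G_m(f,\Psi,\varrho)\|_p\le K\|f\|_p$ for all $f\in L_p$, $\varrho\in D(f)$ and $m$, and that $\Psi$ is uniformly bounded, i.e. there is a constant $M$ with $|\psi_k|\le M$ $\mu$-almost everywhere for all $k$. Let $A_1(\Psi)$ be the closure in $L_p$ of the convex hull of $\{\pm\psi_k\}_{k\ge1}$, let $\|f\|_{A_1(\Psi)}=\inf\{t>0: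 f/t\in A_1(\Psi)\}$ (with $\inf\emptyset=\infty$), and for $\alpha\in[0,1]$ let $$ \gamma_m(\alpha,p,\Psi)=\sup_{f\neq0,\ \|f\|_{A_1(\Psi)}<\infty}\ \sup_{\varrho\in D(f)}\frac{\|f-G_m(f,\Psi,\varrho)\|_p}{\|f\|_p^{1-\alpha}\,\|f\|_{A_1(\Psi)}^{\alpha}}. $$ Then there are constants $c,C>0$, depending only on $p$ and $\Psi$ (not on $\alpha$ or $m$), such that for all $\alpha\in[0,1]$ and all integers $m\ge1$ $$ c\,m^{-\alpha/2}\le\gamma_m(\alpha,p,\Psi)\le C\,m^{-\alpha/2}. $$ In particular, with $p^*=\min(p,2)$, if $p\ge2$ then the upper bound of order $m^{-\alpha(1-1/p^*)}$ for $\gamma_m(\alpha,p,\Psi)$ is sharp for every such $\Psi$: for all $\alpha\in[0,1]$ and $m\ge1$ $$ c\,m^{-\alpha(1-1/p^*)}\le\gamma_m(\alpha,p,\Psi)\le C\,m^{-\alpha(1-1/p^*)}. $$ -/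

import Mathlib

namespace TGA

open MeasureTheory
open scoped ENNReal

noncomputable section

section Basis

variable {X : Type*} [NormedAddCommGroup X] [NormedSpace ℝ X]

/-- The basis is semi-normalized: `0 < c₀ ≤ ‖ψ_k‖ ≤ 1` for all `k`. -/
def IsSemiNormalized (Ψ : SchauderBasis ℝ X) : Prop :=
  ∃ c₀ : ℝ, 0 < c₀ ∧ ∀ k, c₀ ≤ ‖Ψ k‖ ∧ ‖Ψ k‖ ≤ 1

/-- `ϱ` enumerates the coefficients of `f` in decreasing order: it lists pairwise distinct indices,
misses no index with a non-zero coefficient, and `|c_{ϱ(0)}(f)| ≥ |c_{ϱ(1)}(f)| ≥ ⋯`.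
Every decreasing permutation of the index set is of this kind. Surjectivity is required
only onto the support of `f`, since an `f` with infinitely many non-zero coefficients and at least
one zero coefficient admits no decreasing permutation of the whole index set. -/
structure IsDecreasing (Ψ : SchauderBasis ℝ X) (f : X) (ϱ : ℕ → ℕ) : Prop where
  injective : Function.Injective ϱ
  covers : ∀ k, Ψ.coord k f ≠ 0 → k ∈ Set.range ϱ
  antitone : Antitone fun j => |Ψ.coord (ϱ j) f|

/-- The `m`-th greedy approximant `G_m(f, Ψ, ϱ)`. -/
def greedyApproximant (Ψ : SchauderBasis ℝ X) (f : X) (ϱ : ℕ → ℕ) (m : ℕ) : X :=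
  ∑ j ∈ Finset.range m, Ψ.coord (ϱ j) f • Ψ (ϱ j)

/-- Quasi-greedy basis: `sup_m ‖G_m(f, Ψ, ϱ)‖ ≤ C ‖f‖`, with `C` independent of `f` and `ϱ`. -/
def IsQuasiGreedy (Ψ : SchauderBasis ℝ X) : Prop :=
  ∃ C : ℝ, ∀ (f : X) (ϱ : ℕ → ℕ), IsDecreasing Ψ f ϱ →
    ∀ m, ‖greedyApproximant Ψ f ϱ m‖ ≤ C * ‖f‖

/-- `A₁(Ψ)`: the closure of the convex hull of `{±ψ_k}`. -/
def A₁ (Ψ : SchauderBasis ℝ X) : Set X :=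
  closure (convexHull ℝ {g | ∃ k, g = Ψ k ∨ g = -Ψ k})

/-- `‖f‖_{A₁(Ψ)} = inf {M > 0 : f / M ∈ A₁(Ψ)}`, equal to `∞` if there is no such `M`. -/
def A₁Norm (Ψ : SchauderBasis ℝ X) (f : X) : ℝ≥0∞ :=
  sInf (ENNReal.ofReal '' {M : ℝ | 0 < M ∧ M⁻¹ • f ∈ A₁ Ψ})

/-- `γ_m(α, X, Ψ)`, the supremum of `‖f - G_m(f, Ψ, ϱ)‖ / (‖f‖ ^ (1 - α) * ‖f‖_{A₁(Ψ)} ^ α)` over all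
non-zero `f` with `‖f‖_{A₁(Ψ)} < ∞` and all decreasing enumerations `ϱ`, as an element of
`[0, ∞]`. -/
def gamma (Ψ : SchauderBasis ℝ X) (α : ℝ) (m : ℕ) : ℝ≥0∞ :=
  ⨆ (f : X) (_ : f ≠ 0) (_ : A₁Norm Ψ f < ∞) (ϱ : ℕ → ℕ) (_ : IsDecreasing Ψ f ϱ),
    ‖f - greedyApproximant Ψ f ϱ m‖ₑ / (‖f‖ₑ ^ (1 - α) * A₁Norm Ψ f ^ α)

end Basis

/-- A basis of `L_p(Ω, μ)` is uniformly bounded: `|ψ_k| ≤ M` almost everywhere, for all `k`. -/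
def IsUniformlyBounded {Ω : Type*} [MeasurableSpace Ω] {μ : Measure Ω} {p : ℝ≥0∞}
    [Fact (1 ≤ p)] (Ψ : SchauderBasis ℝ (Lp ℝ p μ)) : Prop :=
  ∃ M : ℝ, ∀ k, ∀ᵐ x ∂μ, |(Ψ k : Lp ℝ p μ) x| ≤ M

end

end TGA

namespace TGA

open MeasureTheory Filter Topology
open scoped ENNReal

/-! ### Signed sums in a quasi-greedy basis -/

section Abstract

variable {X : Type*} [NormedAddCommGroup X] [NormedSpace ℝ X]

/-! Everything rests on `‖∑_{k∈Λ} ±ψ_k‖ ≍ √|Λ|`, uniformly in `Λ` and the signs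
(`exists_sum_bounds`). Quasi-greediness makes all sign choices on `Λ` comparable
(`norm_sum_sign_le`), so one good choice suffices for each inequality. `exists_signs` picks signs
one at a time, keeping the mean of `a S² - b cosh (S/σ)` large, where `S` is the signed sum and `σ =
M √|Λ|`. With `a = 0` this bounds an exponential moment, hence every `L_p` norm. With `a = σ⁻²` it
plays a large second moment against that exponential moment, so the first moment is at least of
order `√|Λ|`.

For the upper bound on `γ_m`, `‖f‖_{A₁}` dominates the `ℓ¹` norm of the coefficients. Cutting the
greedy order into blocks of length `m` gives `‖f - G_m‖ ≤ B m^{-1/2} ‖f‖_{A₁}`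
(`norm_sub_greedyApproximant_le`). The geometric mean of this and `‖f - G_m‖ ≤ (K+1) ‖f‖` is the
claim. For the lower bound, the sum of the first `2m` basis elements is extremal up to constants
(`le_gamma`). -/

lemma coord_basis (Ψ : SchauderBasis ℝ X) (k i : ℕ) :
    Ψ.coord k (Ψ i) = if k = i then 1 else 0 := by
  classical
  rw [Ψ.ortho]
  by_cases h : k = i <;> simp [h]

lemma coord_sum (Ψ : SchauderBasis ℝ X) (Λ : Finset ℕ) (c : ℕ → ℝ) (k : ℕ) :
    Ψ.coord k (∑ i ∈ Λ, c i • Ψ i) = if k ∈ Λ then c k else 0 := by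
  simp [map_sum, coord_basis]

/-- There is an enumeration of infinitely many integers that lists `A` first and then the rest
of `Λ`. -/
lemma exists_injective_listing {A Λ : Finset ℕ} (h : A ⊆ Λ) :
    ∃ ϱ : ℕ → ℕ, Function.Injective ϱ ∧ (Finset.range A.card).image ϱ = A ∧
      (Finset.range Λ.card).image ϱ = Λ := by
  set l : List ℕ := A.toList ++ (Λ \ A).toList with hl
  have hnd : l.Nodup := by
    rw [hl, List.nodup_append]
    refine ⟨A.nodup_toList, (Λ \ A).nodup_toList, ?_⟩
    intro a ha b hb
    rw [Finset.mem_toList] at ha hb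
    rintro rfl
    exact (Finset.mem_sdiff.1 hb).2 ha
  have hlen : l.length = Λ.card := by
    have := Finset.card_sdiff_add_card_eq_card h
    simp [hl]
    omega
  have hmem : ∀ k, k ∈ l ↔ k ∈ Λ := by
    intro k
    simp only [hl, List.mem_append, Finset.mem_toList, Finset.mem_sdiff]
    constructor
    · rintro (h1 | h1)
      · exact h h1
      · exact h1.1
    · intro h1
      by_cases h2 : k ∈ A
      · exact Or.inl h2
      · exact Or.inr ⟨h1, h2⟩
  -- Values beyond `Λ.sup id` after the list ends keep `ϱ` injective and off `Λ`.
  let ϱ : ℕ → ℕ := fun i => if hi : i < l.length then l[i] else Λ.sup id + 1 + i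
  have hin : ∀ i (hi : i < l.length), ϱ i = l[i] := fun i hi => by simp [ϱ, hi]
  have hout : ∀ i, ¬ i < l.length → ϱ i = Λ.sup id + 1 + i := fun i hi => by
    simp only [ϱ, hi, dite_false]
  have hle : ∀ i (hi : i < l.length), l[i] ≤ Λ.sup id := fun i hi =>
    Finset.le_sup (f := id) ((hmem _).1 (List.getElem_mem hi))
  have hinj : Function.Injective ϱ := by
    intro i j hij
    by_cases hi : i < l.length <;> by_cases hj : j < l.length
    · rw [hin i hi, hin j hj] at hij
      exact (hnd.getElem_inj_iff).1 hij
    · rw [hin i hi, hout j hj] at hij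
      have := hle i hi
      omega
    · rw [hout i hi, hin j hj] at hij
      have := hle j hj
      omega
    · rw [hout i hi, hout j hj] at hij
      omega
  refine ⟨ϱ, hinj, ?_, ?_⟩
  · refine Finset.eq_of_subset_of_card_le ?_ ?_
    · intro k hk
      obtain ⟨i, hi, rfl⟩ := Finset.mem_image.1 hk
      have hi' : i < A.toList.length := by simpa using hi
      have hi2 : i < l.length := by
        have := Finset.card_le_card h
        have := Finset.mem_range.1 hi
        omega
      rw [hin i hi2]
      simp only [hl, List.getElem_append_left hi']
      exact Finset.mem_toList.1 (List.getElem_mem hi')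
    · rw [Finset.card_image_of_injective _ hinj, Finset.card_range]
  · refine Finset.eq_of_subset_of_card_le ?_ ?_
    · intro k hk
      obtain ⟨i, hi, rfl⟩ := Finset.mem_image.1 hk
      have hi2 : i < l.length := hlen ▸ Finset.mem_range.1 hi
      rw [hin i hi2]
      exact (hmem _).1 (List.getElem_mem hi2)
    · rw [Finset.card_image_of_injective _ hinj, Finset.card_range]

/-- Quasi-greedy bases are suppression unconditional for constant coefficients. -/
lemma norm_sum_subset_le {Ψ : SchauderBasis ℝ X} {K : ℝ}
    (hK : ∀ (f : X) (ϱ : ℕ → ℕ), IsDecreasing Ψ f ϱ →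
      ∀ m, ‖greedyApproximant Ψ f ϱ m‖ ≤ K * ‖f‖)
    {A Λ : Finset ℕ} (h : A ⊆ Λ) (ε : ℕ → ℝ) (hε : ∀ k, |ε k| = 1) :
    ‖∑ k ∈ A, ε k • Ψ k‖ ≤ K * ‖∑ k ∈ Λ, ε k • Ψ k‖ := by
  obtain ⟨ϱ, hinj, hA, hΛ⟩ := exists_injective_listing h
  have hmem : ∀ j, ϱ j ∈ Λ ↔ j < Λ.card := by
    intro j
    constructor
    · intro hj
      rw [← hΛ] at hj
      obtain ⟨i, hi, hij⟩ := Finset.mem_image.1 hj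
      rw [← hinj hij]
      exact Finset.mem_range.1 hi
    · intro hj
      have := Finset.mem_image_of_mem ϱ (Finset.mem_range.2 hj)
      rwa [hΛ] at this
  -- The coefficients have modulus one on `Λ` and zero off it; the ties allow `A` to come first, so
  -- that the greedy sum of length `A.card` is the sum over `A`.
  have hdec : IsDecreasing Ψ (∑ k ∈ Λ, ε k • Ψ k) ϱ := by
    refine ⟨hinj, ?_, ?_⟩
    · intro k hk
      rw [coord_sum] at hk
      have hkΛ : k ∈ Λ := by
        by_contra hcon
        simp [hcon] at hk
      rw [← hΛ] at hkΛ
      obtain ⟨i, -, hi⟩ := Finset.mem_image.1 hkΛ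
      exact ⟨i, hi⟩
    · intro i j hij
      simp only [coord_sum, hmem]
      by_cases hj : j < Λ.card
      · have hi : i < Λ.card := by omega
        simp [hi, hj, hε]
      · simp [hj]
  have := hK _ ϱ hdec A.card
  convert this using 2
  rw [greedyApproximant]
  conv_lhs => rw [← hA]
  rw [Finset.sum_image (fun i _ j _ hij => hinj hij)]
  refine Finset.sum_congr rfl fun j hj => ?_
  have : ϱ j ∈ Λ := (hmem j).2 ((Finset.mem_range.1 hj).trans_le (Finset.card_le_card h))
  rw [coord_sum, if_pos this]

/-- For a quasi-greedy basis, all sums with coefficients `±1` over the same index set have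
comparable norms. -/
lemma norm_sum_sign_le {Ψ : SchauderBasis ℝ X} {K : ℝ}
    (hK : ∀ (f : X) (ϱ : ℕ → ℕ), IsDecreasing Ψ f ϱ →
      ∀ m, ‖greedyApproximant Ψ f ϱ m‖ ≤ K * ‖f‖)
    (Λ : Finset ℕ) (ε η : ℕ → ℝ) (hε : ∀ k, |ε k| = 1) (hη : ∀ k, |η k| = 1) :
    ‖∑ k ∈ Λ, η k • Ψ k‖ ≤ 2 * K * ‖∑ k ∈ Λ, ε k • Ψ k‖ := by
  classical
  have h1 := norm_sum_subset_le hK (Finset.filter_subset (fun k => η k = ε k) Λ) ε hε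
  have h2 := norm_sum_subset_le hK (Finset.filter_subset (fun k => ¬ η k = ε k) Λ) ε hε
  have : ∑ k ∈ Λ, η k • Ψ k = ∑ k ∈ Λ with η k = ε k, ε k • Ψ k
      - ∑ k ∈ Λ with ¬ η k = ε k, ε k • Ψ k := by
    rw [← Finset.sum_filter_add_sum_filter_not Λ (fun k => η k = ε k), sub_eq_add_neg,
      ← Finset.sum_neg_distrib]
    congr 1
    · exact Finset.sum_congr rfl fun k hk => by rw [(Finset.mem_filter.1 hk).2]
    · refine Finset.sum_congr rfl fun k hk => ?_
      have hne := (Finset.mem_filter.1 hk).2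
      have : η k = - ε k := by
        rcases abs_eq_abs.1 ((hη k).trans (hε k).symm) with h | h
        · exact absurd h hne
        · exact h
      rw [this, neg_smul]
  rw [this]
  refine (norm_sub_le _ _).trans ?_
  linarith

/-- A bound for all sums with coefficients `±1` carries over to coefficients in `[-1, 1]`. -/
lemma norm_add_sum_le_of_signs (v : ℕ → X) (B : ℝ) (Λ : Finset ℕ) :
    ∀ w : X, (∀ η : ℕ → ℝ, (∀ k, |η k| = 1) → ‖w + ∑ k ∈ Λ, η k • v k‖ ≤ B) →
      ∀ c : ℕ → ℝ, (∀ k ∈ Λ, |c k| ≤ 1) → ‖w + ∑ k ∈ Λ, c k • v k‖ ≤ B := by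
  classical
  induction Λ using Finset.induction_on with
  | empty =>
    intro w h c _
    simpa using h (fun _ => 1) (by simp)
  | insert a s ha ih =>
    intro w h c hc
    -- The term at `a` with sign `δ` is absorbed into `w`. Then `c a` is a convex combination of `1`
    -- and `-1`, and the norm is convex.
    have key : ∀ δ : ℝ, |δ| = 1 → ‖(w + δ • v a) + ∑ k ∈ s, c k • v k‖ ≤ B := by
      intro δ hδ
      refine ih _ (fun η hη => ?_) c fun k hk => hc k (Finset.mem_insert_of_mem hk)
      have := h (Function.update η a δ) (fun k => by
        by_cases hk : k = a
        · subst hk; simpa using hδ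
        · simpa [hk] using hη k)
      rw [Finset.sum_insert ha, Function.update_self, ← add_assoc] at this
      convert this using 3
      refine Finset.sum_congr rfl fun k hk => ?_
      rw [Function.update_of_ne (fun hka : k = a => ha (hka ▸ hk))]
    have h1 := key 1 (by simp)
    have h2 := key (-1) (by simp)
    have hca := abs_le.1 (hc a (Finset.mem_insert_self a s))
    rw [Finset.sum_insert ha]
    set S := ∑ k ∈ s, c k • v k
    have e : w + (c a • v a + S) = ((1 + c a) / 2) • ((w + (1 : ℝ) • v a) + S)
        + ((1 - c a) / 2) • ((w + (-1 : ℝ) • v a) + S) := by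
      module
    rw [e]
    refine (norm_add_le _ _).trans ?_
    rw [norm_smul, norm_smul, Real.norm_of_nonneg (by linarith), Real.norm_of_nonneg (by linarith)]
    nlinarith

lemma norm_sum_le_of_signs (v : ℕ → X) (B : ℝ) (Λ : Finset ℕ)
    (h : ∀ η : ℕ → ℝ, (∀ k, |η k| = 1) → ‖∑ k ∈ Λ, η k • v k‖ ≤ B)
    (c : ℕ → ℝ) {t : ℝ} (ht0 : 0 ≤ t) (hc : ∀ k ∈ Λ, |c k| ≤ t) :
    ‖∑ k ∈ Λ, c k • v k‖ ≤ t * B := by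
  rcases ht0.eq_or_lt with ht | ht
  · subst ht
    have hz : ∑ k ∈ Λ, c k • v k = 0 := Finset.sum_eq_zero fun k hk => by
      rw [abs_nonpos_iff.1 (hc k hk), zero_smul]
    simp [hz]
  have := norm_add_sum_le_of_signs v B Λ 0 (by simpa using h) (fun k => t⁻¹ * c k) (fun k hk => by
    rw [abs_mul, abs_inv, abs_of_pos ht]
    exact (inv_mul_le_iff₀ ht).2 (by simpa using hc k hk))
  have e : ∑ k ∈ Λ, c k • v k = t • ∑ k ∈ Λ, (t⁻¹ * c k) • v k := by
    rw [Finset.smul_sum]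
    refine Finset.sum_congr rfl fun k _ => ?_
    rw [smul_smul, mul_inv_cancel_left₀ ht.ne']
  rw [e, norm_smul, Real.norm_of_nonneg ht0]
  rw [zero_add] at this
  exact mul_le_mul_of_nonneg_left this ht0

end Abstract

/-! ### From square-root bounds on sums to bounds on `γ_m` -/

section Gamma

variable {X : Type*} [NormedAddCommGroup X] [NormedSpace ℝ X]

/-- The set cut out by this inequality is closed and convex and contains every `±ψ_i`, hence all of
`A₁ Ψ`. -/
lemma sum_abs_coord_le_one (Ψ : SchauderBasis ℝ X) {g : X} (hg : g ∈ A₁ Ψ) (F : Finset ℕ) :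
    ∑ k ∈ F, |Ψ.coord k g| ≤ 1 := by
  have hclosed : IsClosed {g : X | ∑ k ∈ F, |Ψ.coord k g| ≤ 1} := by
    refine isClosed_le ?_ continuous_const
    exact continuous_finsetSum _ fun k _ => (Ψ.coord k).continuous.abs
  have hconv : Convex ℝ {g : X | ∑ k ∈ F, |Ψ.coord k g| ≤ 1} := by
    intro x hx y hy a b ha hb hab
    simp only [Set.mem_ofPred_eq] at hx hy ⊢
    calc ∑ k ∈ F, |Ψ.coord k (a • x + b • y)|
        ≤ ∑ k ∈ F, (a * |Ψ.coord k x| + b * |Ψ.coord k y|) := by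
          refine Finset.sum_le_sum fun k _ => ?_
          rw [map_add, map_smul, map_smul, smul_eq_mul, smul_eq_mul]
          refine (abs_add_le _ _).trans ?_
          rw [abs_mul, abs_mul, abs_of_nonneg ha, abs_of_nonneg hb]
      _ = a * ∑ k ∈ F, |Ψ.coord k x| + b * ∑ k ∈ F, |Ψ.coord k y| := by
          rw [Finset.sum_add_distrib, Finset.mul_sum, Finset.mul_sum]
      _ ≤ 1 := by nlinarith
  have hbasis : ∀ i, ∑ k ∈ F, |Ψ.coord k (Ψ i)| ≤ 1 := by
    intro i
    have : ∀ k, |Ψ.coord k (Ψ i)| = if k = i then 1 else 0 := fun k => by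
      rw [coord_basis]
      by_cases h : k = i <;> simp [h]
    simp only [this, Finset.sum_ite_eq']
    split_ifs <;> norm_num
  refine closure_minimal (convexHull_min ?_ hconv) hclosed hg
  rintro _ ⟨i, rfl | rfl⟩
  · exact hbasis i
  · simpa using hbasis i

lemma sum_abs_coord_le (Ψ : SchauderBasis ℝ X) {f : X} (hf : A₁Norm Ψ f < ∞) (F : Finset ℕ) :
    ∑ k ∈ F, |Ψ.coord k f| ≤ (A₁Norm Ψ f).toReal := by
  have : ENNReal.ofReal (∑ k ∈ F, |Ψ.coord k f|) ≤ A₁Norm Ψ f := by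
    refine le_sInf ?_
    rintro _ ⟨M, ⟨hM, hfM⟩, rfl⟩
    refine ENNReal.ofReal_le_ofReal ?_
    have := sum_abs_coord_le_one Ψ hfM F
    simp only [map_smul, smul_eq_mul, abs_mul, abs_inv, abs_of_pos hM, ← Finset.mul_sum] at this
    simpa using (inv_mul_le_iff₀ hM).1 this
  exact (ENNReal.ofReal_le_iff_le_toReal hf.ne).1 this

/-- Triangle inequality along the basis expansion. It makes `‖f‖_{A₁}` positive for `f ≠ 0`, so the
quotient in `gamma` can be handled in the reals. -/
lemma norm_le_A₁Norm {Ψ : SchauderBasis ℝ X} (hΨ : ∀ k, ‖Ψ k‖ ≤ 1) {f : X}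
    (hf : A₁Norm Ψ f < ∞) : ‖f‖ ≤ (A₁Norm Ψ f).toReal := by
  refine le_of_tendsto (SchauderBasis.tendsto_proj Ψ f).norm (Eventually.of_forall fun n => ?_)
  rw [SchauderBasis.proj_apply]
  refine (norm_sum_le _ _).trans (le_trans (Finset.sum_le_sum fun k _ => ?_)
    (sum_abs_coord_le Ψ hf (Finset.range n)))
  rw [norm_smul, Real.norm_eq_abs]
  exact mul_le_of_le_one_right (abs_nonneg _) (hΨ k)

lemma A₁Norm_sum_range_le (Ψ : SchauderBasis ℝ X) {n : ℕ} (hn : 0 < n) :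
    A₁Norm Ψ (∑ k ∈ Finset.range n, Ψ k) ≤ ENNReal.ofReal n := by
  have hn' : (0 : ℝ) < n := by exact_mod_cast hn
  refine sInf_le ⟨n, ⟨hn', subset_closure ?_⟩, rfl⟩
  rw [Finset.smul_sum]
  refine (convex_convexHull ℝ _).sum_mem (fun _ _ => by positivity) ?_
    fun k _ => subset_convexHull ℝ _ ⟨k, Or.inl rfl⟩
  rw [Finset.sum_const, Finset.card_range, nsmul_eq_mul, mul_inv_cancel₀ hn'.ne']

/-- Greedy approximants converge when the coefficients are absolutely summable. -/
lemma tendsto_greedyApproximant [CompleteSpace X] {Ψ : SchauderBasis ℝ X} (hΨ : ∀ k, ‖Ψ k‖ ≤ 1)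
    {f : X} (hf : A₁Norm Ψ f < ∞) {ϱ : ℕ → ℕ} (hϱ : IsDecreasing Ψ f ϱ) :
    Tendsto (greedyApproximant Ψ f ϱ) atTop (𝓝 f) := by
  -- Absolute summability makes the expansion unconditional, so it may be re-indexed along `ϱ`,
  -- which skips only zero coefficients.
  have hs : Summable fun k => |Ψ.coord k f| :=
    summable_of_sum_le (fun _ => abs_nonneg _) (sum_abs_coord_le Ψ hf)
  have hs' : Summable fun k => Ψ.coord k f • Ψ k :=
    Summable.of_norm_bounded hs fun k => by
      rw [norm_smul, Real.norm_eq_abs]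
      exact mul_le_of_le_one_right (abs_nonneg _) (hΨ k)
  have hsum : HasSum (fun k => Ψ.coord k f • Ψ k) f := by
    have h1 := hs'.hasSum.tendsto_sum_nat
    have h2 := SchauderBasis.tendsto_proj Ψ f
    simp only [SchauderBasis.proj_apply] at h2
    have := hs'.hasSum
    rwa [tendsto_nhds_unique h1 h2] at this
  have h3 := (hϱ.injective.hasSum_iff (f := fun k => Ψ.coord k f • Ψ k) (a := f) (by
    intro k hk
    have : Ψ.coord k f = 0 := by
      by_contra hne
      exact hk (hϱ.covers k hne)
    simp [this])).2 hsum
  exact h3.tendsto_sum_nat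

/-- In the greedy order, each coefficient of a block of length `m` is at most the mean of the
preceding block. The block's norm is thus at most `B √m` times that mean, i.e. `B / √m` times the
preceding block's `ℓ¹` sum. These bounds add up to the full `ℓ¹` norm. -/
lemma norm_sub_greedyApproximant_le [CompleteSpace X] {Ψ : SchauderBasis ℝ X}
    (hΨ : ∀ k, ‖Ψ k‖ ≤ 1) {B : ℝ}
    (hB : ∀ (Λ : Finset ℕ) (c : ℕ → ℝ) (t : ℝ), 0 ≤ t → (∀ k ∈ Λ, |c k| ≤ t) →
      ‖∑ k ∈ Λ, c k • Ψ k‖ ≤ t * (B * √Λ.card))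
    (hB0 : 0 ≤ B) {f : X} (hf : A₁Norm Ψ f < ∞) {ϱ : ℕ → ℕ} (hϱ : IsDecreasing Ψ f ϱ) {m : ℕ}
    (hm : 1 ≤ m) :
    ‖f - greedyApproximant Ψ f ϱ m‖ ≤ B / √m * (A₁Norm Ψ f).toReal := by
  have hm0 : (0 : ℝ) < m := by exact_mod_cast hm
  set a : ℕ → ℝ := fun j => |Ψ.coord (ϱ j) f| with ha
  have block : ∀ R : ℕ, ‖greedyApproximant Ψ f ϱ ((R + 1) * m + m)
      - greedyApproximant Ψ f ϱ ((R + 1) * m)‖ ≤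
        B / √m * ∑ i ∈ Finset.range m, a (R * m + i) := by
    intro R
    have e : greedyApproximant Ψ f ϱ ((R + 1) * m + m) - greedyApproximant Ψ f ϱ ((R + 1) * m)
        = ∑ k ∈ (Finset.range m).image (fun i => ϱ ((R + 1) * m + i)), Ψ.coord k f • Ψ k := by
      rw [Finset.sum_image (fun i _ j _ hij => by
        have := hϱ.injective hij
        omega), greedyApproximant, Finset.sum_range_add, greedyApproximant, add_sub_cancel_left]
    have hcard : ((Finset.range m).image (fun i => ϱ ((R + 1) * m + i))).card = m := by
      rw [Finset.card_image_of_injective _ (fun i j hij => by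
        have := hϱ.injective hij
        omega), Finset.card_range]
    have h1 := hB ((Finset.range m).image (fun i => ϱ ((R + 1) * m + i)))
      (fun k => Ψ.coord k f) (a ((R + 1) * m)) (abs_nonneg _) (by
        intro k hk
        obtain ⟨i, -, rfl⟩ := Finset.mem_image.1 hk
        exact hϱ.antitone (Nat.le_add_right _ _))
    rw [← e, hcard] at h1
    refine h1.trans ?_
    have h2 : m * a ((R + 1) * m) ≤ ∑ i ∈ Finset.range m, a (R * m + i) := by
      have := Finset.card_nsmul_le_sum (Finset.range m) (fun i => a (R * m + i))
        (a ((R + 1) * m)) (fun i hi => hϱ.antitone (by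
          have := Finset.mem_range.1 hi
          rw [add_mul]
          omega))
      simpa using this
    have h3 : a ((R + 1) * m) * (B * √m) = B / √m * (m * a ((R + 1) * m)) := by
      have : √(m : ℝ) * √m = m := Real.mul_self_sqrt hm0.le
      field_simp
      linear_combination (a ((R + 1) * m) * B) * this
    rw [h3]
    exact mul_le_mul_of_nonneg_left h2 (by positivity)
  have main : ∀ R : ℕ, ‖greedyApproximant Ψ f ϱ ((R + 1) * m) - greedyApproximant Ψ f ϱ m‖ ≤
      B / √m * ∑ j ∈ Finset.range (R * m), a j := by
    intro R
    induction R with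
    | zero => simp
    | succ R ih =>
      have e1 : (R + 1 + 1) * m = (R + 1) * m + m := by ring
      have e2 : (R + 1) * m = R * m + m := by ring
      have e3 : ∑ j ∈ Finset.range ((R + 1) * m), a j = ∑ j ∈ Finset.range (R * m), a j
          + ∑ i ∈ Finset.range m, a (R * m + i) := by
        rw [e2, Finset.sum_range_add]
      rw [e1, e3, mul_add]
      have := norm_add_le (greedyApproximant Ψ f ϱ ((R + 1) * m) - greedyApproximant Ψ f ϱ m)
        (greedyApproximant Ψ f ϱ ((R + 1) * m + m) - greedyApproximant Ψ f ϱ ((R + 1) * m))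
      rw [sub_add_sub_cancel'] at this
      linarith [block R]
  have hlim : Tendsto (fun R : ℕ => ‖greedyApproximant Ψ f ϱ ((R + 1) * m)
      - greedyApproximant Ψ f ϱ m‖) atTop (𝓝 ‖f - greedyApproximant Ψ f ϱ m‖) := by
    refine ((((tendsto_greedyApproximant hΨ hf hϱ).comp ?_)).sub_const _).norm
    exact tendsto_atTop_mono (fun R => (Nat.le_succ R).trans (Nat.le_mul_of_pos_right _ hm))
      tendsto_id
  refine le_of_tendsto hlim (Eventually.of_forall fun R => (main R).trans ?_)
  refine mul_le_mul_of_nonneg_left ?_ (by positivity)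
  have := sum_abs_coord_le Ψ hf ((Finset.range (R * m)).image ϱ)
  rwa [Finset.sum_image (fun i _ j _ hij => hϱ.injective hij)] at this

/-- Both error bounds hold with the common constant `K + 1 + B`; raising them to the powers `1 - α`
and `α` and multiplying leaves a constant free of `α`. -/
lemma gamma_le [CompleteSpace X] {Ψ : SchauderBasis ℝ X} (hΨ : ∀ k, ‖Ψ k‖ ≤ 1) {B K : ℝ}
    (hB : ∀ (Λ : Finset ℕ) (c : ℕ → ℝ) (t : ℝ), 0 ≤ t → (∀ k ∈ Λ, |c k| ≤ t) →
      ‖∑ k ∈ Λ, c k • Ψ k‖ ≤ t * (B * √Λ.card)) (hB0 : 0 < B) (hK0 : 0 ≤ K)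
    (hK : ∀ (f : X) (ϱ : ℕ → ℕ), IsDecreasing Ψ f ϱ →
      ∀ m, ‖greedyApproximant Ψ f ϱ m‖ ≤ K * ‖f‖)
    {α : ℝ} (hα : α ∈ Set.Icc (0 : ℝ) 1) {m : ℕ} (hm : 1 ≤ m) :
    gamma Ψ α m ≤ ENNReal.ofReal ((K + 1 + B) * (m : ℝ) ^ (-(α / 2))) := by
  have hm0 : (0 : ℝ) < m := by exact_mod_cast hm
  refine iSup_le fun f => iSup_le fun hf0 => iSup_le fun hf => iSup_le fun ϱ => iSup_le fun hϱ => ?_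
  have hfpos : 0 < ‖f‖ := norm_pos_iff.2 hf0
  set A := (A₁Norm Ψ f).toReal with hA
  have hApos : 0 < A := hfpos.trans_le (norm_le_A₁Norm hΨ hf)
  have hAe : A₁Norm Ψ f = ENNReal.ofReal A := (ENNReal.ofReal_toReal hf.ne).symm
  rw [hAe, ← ofReal_norm, ← ofReal_norm, ENNReal.ofReal_rpow_of_pos hfpos,
    ENNReal.ofReal_rpow_of_pos hApos, ← ENNReal.ofReal_mul (by positivity),
    ← ENNReal.ofReal_div_of_pos (by positivity)]
  refine ENNReal.ofReal_le_ofReal ((div_le_iff₀ (by positivity)).2 ?_)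
  have h1 := norm_sub_greedyApproximant_le hΨ hB hB0.le hf hϱ hm
  have h0 : ‖f - greedyApproximant Ψ f ϱ m‖ ≤ (K + 1) * ‖f‖ := by
    refine (norm_sub_le _ _).trans ?_
    linarith [hK f ϱ hϱ m]
  rw [← hA] at h1
  set N := ‖f - greedyApproximant Ψ f ϱ m‖ with hN
  have hD : 0 < K + 1 + B := by positivity
  have h0' : N ≤ (K + 1 + B) * ‖f‖ := h0.trans (by nlinarith)
  have h1' : N ≤ (K + 1 + B) * (A / √m) := h1.trans (by
    rw [div_mul_eq_mul_div, mul_div_assoc]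
    exact mul_le_mul_of_nonneg_right (by linarith) (by positivity))
  have hN0 : 0 ≤ N := norm_nonneg _
  -- Adding exponents needs a positive base, so `N = 0` is separate, with `0 ^ 0 = 1` when `α = 0`.
  have e : N = N ^ (1 - α) * N ^ α := by
    rcases hN0.eq_or_lt with h | h
    · rw [← h]
      by_cases hα0 : α = 0
      · simp [hα0]
      · rw [Real.zero_rpow hα0, mul_zero]
    · rw [← Real.rpow_add h]
      simp
  have e2 : (K + 1 + B) * (m : ℝ) ^ (-(α / 2)) * (‖f‖ ^ (1 - α) * A ^ α)
      = ((K + 1 + B) * ‖f‖) ^ (1 - α) * ((K + 1 + B) * (A / √m)) ^ α := by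
    rw [Real.mul_rpow hD.le hfpos.le, Real.mul_rpow hD.le (by positivity),
      Real.div_rpow hApos.le (by positivity), Real.sqrt_eq_rpow, ← Real.rpow_mul hm0.le,
      Real.rpow_neg hm0.le]
    have : K + 1 + B = (K + 1 + B) ^ (1 - α) * (K + 1 + B) ^ α := by
      rw [← Real.rpow_add hD]
      simp
    have e3 : (1 / 2 : ℝ) * α = α / 2 := by ring
    rw [e3, div_eq_mul_inv (A ^ α)]
    calc _ = ((K + 1 + B) ^ (1 - α) * (K + 1 + B) ^ α) * ((m : ℝ) ^ (α / 2))⁻¹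
          * (‖f‖ ^ (1 - α) * A ^ α) := by rw [← this]
      _ = _ := by ring
  rw [e2, e]
  refine mul_le_mul (Real.rpow_le_rpow hN0 h0' (by linarith [hα.2]))
    (Real.rpow_le_rpow hN0 h1' hα.1) (by positivity) (by positivity)

lemma isDecreasing_sum_range (Ψ : SchauderBasis ℝ X) (n : ℕ) :
    IsDecreasing Ψ (∑ k ∈ Finset.range n, Ψ k) id := by
  have hc : ∀ k, Ψ.coord k (∑ k ∈ Finset.range n, Ψ k) = if k < n then 1 else 0 := by
    intro k
    simpa using coord_sum Ψ (Finset.range n) (fun _ => 1) k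
  refine ⟨Function.injective_id, fun k _ => ⟨k, rfl⟩, fun i j hij => ?_⟩
  simp only [hc, id]
  by_cases hj : j < n
  · have hi : i < n := by omega
    simp [hi, hj]
  · simp [hj]

/-- For the sum `f` of the first `2m` basis elements the error is the sum of `m` of them, of norm at
least `b √m`, while `‖f‖ ≤ 2B √m` and `‖f‖_{A₁} ≤ 2m`. The constant `2B + 2` exceeds both `2B` and
`2`, so `α` drops out of it. -/
lemma le_gamma {Ψ : SchauderBasis ℝ X} (hΨ : ∀ k, ‖Ψ k‖ ≤ 1) {b B : ℝ} (hb : 0 < b) (hB0 : 0 < B)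
    (hB : ∀ (Λ : Finset ℕ) , ‖∑ k ∈ Λ, Ψ k‖ ≤ B * √Λ.card)
    (hbl : ∀ (Λ : Finset ℕ), b * √Λ.card ≤ ‖∑ k ∈ Λ, Ψ k‖)
    {α : ℝ} (hα : α ∈ Set.Icc (0 : ℝ) 1) {m : ℕ} (hm : 1 ≤ m) :
    ENNReal.ofReal ((b / (2 * B + 2)) * (m : ℝ) ^ (-(α / 2))) ≤ gamma Ψ α m := by
  have hm0 : (0 : ℝ) < m := by exact_mod_cast hm
  set f := ∑ k ∈ Finset.range (m + m), Ψ k with hf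
  have hfpos : 0 < ‖f‖ := by
    refine lt_of_lt_of_le ?_ (hbl (Finset.range (m + m)))
    have : 0 < (Finset.range (m + m)).card := by simp; omega
    positivity
  have hAle := A₁Norm_sum_range_le Ψ (n := m + m) (by omega)
  rw [← hf] at hAle
  have hAfin : A₁Norm Ψ f < ∞ := hAle.trans_lt ENNReal.ofReal_lt_top
  have hdec := isDecreasing_sum_range Ψ (m + m)
  rw [← hf] at hdec
  refine le_trans ?_ (le_iSup_of_le f <| le_iSup_of_le (norm_pos_iff.1 hfpos) <|
    le_iSup_of_le hAfin <| le_iSup_of_le id <| le_iSup_of_le hdec le_rfl)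
  have hdiff : b * √m ≤ ‖f - greedyApproximant Ψ f id m‖ := by
    have hc : ∀ k, Ψ.coord k f = if k < m + m then 1 else 0 := by
      intro k
      simpa [hf] using coord_sum Ψ (Finset.range (m + m)) (fun _ => 1) k
    have hG : greedyApproximant Ψ f id m = ∑ k ∈ Finset.range m, Ψ k := by
      refine Finset.sum_congr rfl fun k hk => ?_
      have : k < m + m := by
        have := Finset.mem_range.1 hk
        omega
      simp [hc, this]
    have : f - greedyApproximant Ψ f id m = ∑ k ∈ Finset.Ico m (m + m), Ψ k := by
      rw [hG, hf, Finset.sum_Ico_eq_sub _ (by omega)]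
    rw [this]
    simpa using hbl (Finset.Ico m (m + m))
  set A := (A₁Norm Ψ f).toReal with hA
  have hApos : 0 < A := hfpos.trans_le (norm_le_A₁Norm hΨ hAfin)
  have hAe : A₁Norm Ψ f = ENNReal.ofReal A := (ENNReal.ofReal_toReal hAfin.ne).symm
  have hA2 : A ≤ 2 * m := by
    have := ENNReal.toReal_mono ENNReal.ofReal_ne_top hAle
    rw [ENNReal.toReal_ofReal (by positivity)] at this
    push_cast at this
    linarith
  have hfle : ‖f‖ ≤ (2 * B) * √m := by
    refine (hB _).trans ?_
    have : √((m + m : ℕ) : ℝ) ≤ 2 * √m := by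
      rw [Real.sqrt_le_left (by positivity)]
      rw [mul_pow, Real.sq_sqrt hm0.le]
      push_cast
      linarith
    rw [Finset.card_range]
    nlinarith
  rw [hAe, ← ofReal_norm, ← ofReal_norm, ENNReal.ofReal_rpow_of_pos hfpos,
    ENNReal.ofReal_rpow_of_pos hApos, ← ENNReal.ofReal_mul (by positivity),
    ← ENNReal.ofReal_div_of_pos (by positivity)]
  refine ENNReal.ofReal_le_ofReal ((le_div_iff₀ (by positivity)).2 (le_trans ?_ hdiff))
  have hs : 0 < √(m : ℝ) := Real.sqrt_pos.2 hm0
  have hD : 0 < 2 * B + 2 := by positivity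
  have h1 : ‖f‖ ^ (1 - α) ≤ ((2 * B + 2) * √m) ^ (1 - α) :=
    Real.rpow_le_rpow hfpos.le (hfle.trans (by nlinarith)) (by linarith [hα.2])
  have h2 : A ^ α ≤ ((2 * B + 2) * √m * √m) ^ α := by
    refine Real.rpow_le_rpow hApos.le (hA2.trans ?_) hα.1
    rw [mul_assoc, Real.mul_self_sqrt hm0.le]
    nlinarith
  have h3 : ((2 * B + 2) * √m) ^ (1 - α) * ((2 * B + 2) * √m * √m) ^ α
      = (2 * B + 2) * √m * (m : ℝ) ^ (α / 2) := by
    rw [Real.mul_rpow (x := (2 * B + 2) * √m) (by positivity) hs.le, ← mul_assoc,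
      ← Real.rpow_add (by positivity), Real.sqrt_eq_rpow, ← Real.rpow_mul hm0.le]
    simp only [sub_add_cancel, Real.rpow_one]
    congr 2
    ring
  calc b / (2 * B + 2) * (m : ℝ) ^ (-(α / 2)) * (‖f‖ ^ (1 - α) * A ^ α)
      ≤ b / (2 * B + 2) * (m : ℝ) ^ (-(α / 2)) * ((2 * B + 2) * √m * (m : ℝ) ^ (α / 2)) := by
        rw [← h3]
        gcongr
    _ = b * √m := by
        have : (0 : ℝ) < (m : ℝ) ^ (α / 2) := by positivity
        rw [Real.rpow_neg hm0.le]
        field_simp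

end Gamma

/-! ### Good signs by averaging -/

section Signs

lemma abs_sum_sign_le {Ω : Type*} {g : ℕ → Ω → ℝ} {M : ℝ} (hgM : ∀ k x, |g k x| ≤ M) {η : ℕ → ℝ}
    (hη : ∀ k, |η k| = 1) (Λ : Finset ℕ) (x : Ω) :
    |∑ k ∈ Λ, η k * g k x| ≤ Λ.card * M := by
  refine (Finset.abs_sum_le_sum_abs _ _).trans ?_
  rw [← nsmul_eq_mul]
  refine Finset.sum_le_card_nsmul _ _ _ fun k _ => ?_
  rw [abs_mul, hη, one_mul]
  exact hgM k x

variable {Ω : Type*} [MeasurableSpace Ω] {μ : Measure Ω} [IsProbabilityMeasure μ]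

lemma integrable_comp_of_abs_le {u : Ω → ℝ} (hu : Measurable u) {R : ℝ} (hR : ∀ x, |u x| ≤ R)
    {φ : ℝ → ℝ} (hφ : Continuous φ) : Integrable (fun x => φ (u x)) μ := by
  obtain ⟨C, hC⟩ := (isCompact_Icc (a := -R) (b := R)).exists_bound_of_continuousOn hφ.continuousOn
  exact Integrable.of_bound (hφ.measurable.comp hu).aestronglyMeasurable C
    (Eventually.of_forall fun x => hC _ (abs_le.1 (hR x)))

/-- One can choose signs for which the exponential moment of a sum of bounded functions is small
while its second moment is large. -/
lemma exists_signs {g : ℕ → Ω → ℝ} (hg : ∀ k, Measurable (g k)) {M : ℝ}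
    (hgM : ∀ k x, |g k x| ≤ M) {σ a : ℝ} (hσ : 0 < σ) (Λ : Finset ℕ) :
    ∀ b : ℝ, 0 ≤ b → ∃ η : ℕ → ℝ, (∀ k, |η k| = 1) ∧
      a * ∑ k ∈ Λ, ∫ x, g k x ^ 2 ∂μ - b * Real.exp (Λ.card * (M ^ 2 / (2 * σ ^ 2))) ≤
        ∫ x, (a * (∑ k ∈ Λ, η k * g k x) ^ 2 - b * Real.cosh ((∑ k ∈ Λ, η k * g k x) / σ)) ∂μ := by
  classical
  induction Λ using Finset.induction_on with
  | empty => exact fun b _ => ⟨fun _ => 1, by simp, by simp⟩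
  | insert i s hi ih =>
    intro b hb
    set q := Real.exp (M ^ 2 / (2 * σ ^ 2)) with hq
    -- Adding one term costs a factor at most `q` in the averaged `cosh`; the free weight `b` pays
    -- for it in advance.
    obtain ⟨η, hη, h⟩ := ih (b * q) (by positivity)
    set S : Ω → ℝ := fun x => ∑ k ∈ s, η k * g k x with hS
    have hSm : Measurable S := Finset.measurable_fun_sum _ fun k _ => (hg k).const_mul _
    have hSb : ∀ x, |S x| ≤ s.card * M := fun x => abs_sum_sign_le hgM hη s x
    have hint : ∀ (b : ℝ) (δ : ℝ), |δ| ≤ 1 → Integrable (fun x => a * (S x + δ * g i x) ^ 2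
        - b * Real.cosh ((S x + δ * g i x) / σ)) μ := by
      intro b δ hδ
      refine integrable_comp_of_abs_le (u := fun x => S x + δ * g i x) (R := s.card * M + M)
        (φ := fun y => a * y ^ 2 - b * Real.cosh (y / σ)) (hSm.add ((hg i).const_mul _)) ?_
        (by fun_prop)
      intro x
      refine (abs_add_le _ _).trans (add_le_add (hSb x) ?_)
      rw [abs_mul]
      exact (mul_le_of_le_one_left (abs_nonneg _) hδ).trans (hgM i x)
    have hgi : Integrable (fun x => a * g i x ^ 2) μ :=
      integrable_comp_of_abs_le (φ := fun y => a * y ^ 2) (hg i) (hgM i) (by fun_prop)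
    -- Averaging over the new sign cancels the cross term of the square, leaving `a g²`, and
    -- multiplies `cosh (S/σ)` by `cosh (g/σ) ≤ q`.
    have hpt : ∀ x, (a * S x ^ 2 - b * q * Real.cosh (S x / σ)) + a * g i x ^ 2 ≤
        2⁻¹ * ((a * (S x + 1 * g i x) ^ 2 - b * Real.cosh ((S x + 1 * g i x) / σ))
          + (a * (S x + (-1) * g i x) ^ 2 - b * Real.cosh ((S x + (-1) * g i x) / σ))) := by
      intro x
      have e : Real.cosh ((S x + 1 * g i x) / σ) + Real.cosh ((S x + (-1) * g i x) / σ)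
          = 2 * (Real.cosh (S x / σ) * Real.cosh (g i x / σ)) := by
        rw [one_mul, neg_one_mul, ← sub_eq_add_neg, add_div, sub_div, Real.cosh_add, Real.cosh_sub]
        ring
      have hc : Real.cosh (g i x / σ) ≤ q := by
        refine (Real.cosh_le_exp_half_sq _).trans (Real.exp_le_exp.2 ?_)
        rw [div_pow, div_div, mul_comm (σ ^ 2)]
        exact div_le_div_of_nonneg_right
          (sq_le_sq' (abs_le.1 (hgM i x)).1 (abs_le.1 (hgM i x)).2) (by positivity)
      have hc2 := mul_le_mul_of_nonneg_left hc
        (mul_nonneg hb (Real.cosh_pos (S x / σ)).le)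
      nlinarith
    have hsum : a * ∑ k ∈ insert i s, ∫ x, g k x ^ 2 ∂μ
        - b * Real.exp ((insert i s).card * (M ^ 2 / (2 * σ ^ 2))) ≤
        2⁻¹ * (∫ x, (a * (S x + 1 * g i x) ^ 2 - b * Real.cosh ((S x + 1 * g i x) / σ)) ∂μ
          + ∫ x, (a * (S x + (-1) * g i x) ^ 2 - b * Real.cosh ((S x + (-1) * g i x) / σ)) ∂μ) := by
      rw [← integral_add (hint b 1 (by simp)) (hint b (-1) (by simp)), ← integral_const_mul]
      have hI0 : Integrable (fun x => a * S x ^ 2 - b * q * Real.cosh (S x / σ)) μ := by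
        simpa using hint (b * q) 0 (by simp)
      refine le_trans ?_ (integral_mono (hI0.add hgi)
        (((hint b 1 (by simp)).add (hint b (-1) (by simp))).const_mul _) hpt)
      have hadd : ∫ x, ((fun x => a * S x ^ 2 - b * q * Real.cosh (S x / σ))
          + fun x => a * g i x ^ 2) x ∂μ = ∫ x, (a * S x ^ 2 - b * q * Real.cosh (S x / σ)) ∂μ
            + a * ∫ x, g i x ^ 2 ∂μ := by
        rw [← integral_const_mul]
        exact integral_add hI0 hgi
      rw [hadd, Finset.sum_insert hi, Finset.card_insert_of_notMem hi]
      have hexp : Real.exp (((s.card + 1 : ℕ) : ℝ) * (M ^ 2 / (2 * σ ^ 2)))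
          = q * Real.exp (s.card * (M ^ 2 / (2 * σ ^ 2))) := by
        rw [hq, ← Real.exp_add]
        congr 1
        push_cast
        ring
      rw [hexp]
      linarith
    -- One of the two signs does at least as well as their average.
    have hcase : ∃ δ : ℝ, |δ| = 1 ∧ a * ∑ k ∈ insert i s, ∫ x, g k x ^ 2 ∂μ
        - b * Real.exp ((insert i s).card * (M ^ 2 / (2 * σ ^ 2))) ≤
        ∫ x, (a * (S x + δ * g i x) ^ 2 - b * Real.cosh ((S x + δ * g i x) / σ)) ∂μ := by
      by_contra! hcon
      have h1 := hcon 1 (by simp)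
      have h2 := hcon (-1) (by simp)
      linarith
    obtain ⟨δ, hδ, hfin⟩ := hcase
    refine ⟨Function.update η i δ, fun k => ?_, hfin.trans_eq ?_⟩
    · by_cases hk : k = i
      · subst hk; simpa using hδ
      · simpa [hk] using hη k
    · congr 1
      ext x
      have : ∑ k ∈ insert i s, Function.update η i δ k * g k x = S x + δ * g i x := by
        rw [Finset.sum_insert hi, Function.update_self, add_comm]
        congr 1
        refine Finset.sum_congr rfl fun k hk => ?_
        rw [Function.update_of_ne (fun hka : k = i => hi (hka ▸ hk))]
      rw [this]

lemma abs_pow_le_factorial_mul_cosh (n : ℕ) (y : ℝ) :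
    |y| ^ n ≤ 2 * n.factorial * Real.cosh y := by
  have h1 := Real.pow_div_factorial_le_exp |y| (abs_nonneg y) n
  have h2 : Real.exp |y| ≤ 2 * Real.cosh y := by
    rw [← Real.cosh_abs, Real.cosh_eq]
    linarith [Real.exp_pos (-|y|)]
  have h3 : (0 : ℝ) < n.factorial := by exact_mod_cast n.factorial_pos
  rw [div_le_iff₀ h3] at h1
  nlinarith

/-- Some choice of signs makes the `r`-th moment of a sum of `n` bounded functions at most of the
order `n ^ (r / 2)`. -/
lemma exists_signs_integral_rpow_le {g : ℕ → Ω → ℝ} (hg : ∀ k, Measurable (g k)) {M : ℝ}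
    (hM : 0 < M) (hgM : ∀ k x, |g k x| ≤ M) {r : ℝ} (hr : 0 ≤ r) :
    ∃ D : ℝ, 0 < D ∧ ∀ Λ : Finset ℕ, ∃ η : ℕ → ℝ, (∀ k, |η k| = 1) ∧
      ∫ x, |∑ k ∈ Λ, η k * g k x| ^ r ∂μ ≤ D * (M * √Λ.card) ^ r := by
  obtain ⟨N, hN⟩ := exists_nat_ge r
  set Q : ℝ := 1 + 2 * N.factorial with hQ
  have hQ0 : 0 < Q := by positivity
  have hmom : ∀ y : ℝ, |y| ^ r ≤ Q * Real.cosh y := by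
    intro y
    have hc := Real.one_le_cosh y
    have hn := abs_pow_le_factorial_mul_cosh N y
    have : |y| ^ r ≤ 1 + |y| ^ N := by
      rcases le_total |y| 1 with h | h
      · have h1 := Real.rpow_le_one (abs_nonneg y) h hr
        have : 0 ≤ |y| ^ N := by positivity
        linarith
      · have h1 := Real.rpow_le_rpow_of_exponent_le h hN
        rw [Real.rpow_natCast] at h1
        linarith
    rw [hQ]
    nlinarith
  refine ⟨Q * Real.exp 2⁻¹, by positivity, fun Λ => ?_⟩
  -- For empty `Λ` the scale `σ` would vanish; if also `r = 0`, then `0 ^ 0 = 1` on both sides and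
  -- `1 ≤ D` is needed.
  rcases Λ.eq_empty_or_nonempty with rfl | hne
  · refine ⟨fun _ => 1, by simp, ?_⟩
    rcases hr.eq_or_lt with h | h
    · subst h
      have : 1 ≤ Real.exp 2⁻¹ := Real.one_le_exp (by norm_num)
      have h2 : 1 ≤ Q := by rw [hQ]; linarith [show (0 : ℝ) < N.factorial by positivity]
      simp
      nlinarith
    · simp [Real.zero_rpow h.ne']
  have hcard : (0 : ℝ) < Λ.card := by exact_mod_cast hne.card_pos
  -- This scale makes the exponent in `exists_signs` equal to `1/2`, whatever the size of `Λ`.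
  set σ := M * √Λ.card with hσ
  have hσ0 : 0 < σ := by positivity
  obtain ⟨η, hη, h⟩ := exists_signs (μ := μ) hg hgM hσ0 (a := 0) Λ 1 zero_le_one
  refine ⟨η, hη, ?_⟩
  set S : Ω → ℝ := fun x => ∑ k ∈ Λ, η k * g k x with hS
  have hSm : Measurable S := Finset.measurable_fun_sum _ fun k _ => (hg k).const_mul _
  have hSb : ∀ x, |S x| ≤ Λ.card * M := fun x => abs_sum_sign_le hgM hη Λ x
  have hexp : (Λ.card : ℝ) * (M ^ 2 / (2 * σ ^ 2)) = 2⁻¹ := by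
    rw [hσ, mul_pow, Real.sq_sqrt hcard.le]
    field_simp
  have hcosh : ∫ x, Real.cosh (S x / σ) ∂μ ≤ Real.exp 2⁻¹ := by
    simp only [zero_mul, one_mul, zero_sub, integral_neg, hexp] at h
    linarith
  have hI1 : Integrable (fun x => |S x| ^ r) μ :=
    integrable_comp_of_abs_le (φ := fun y => |y| ^ r) hSm hSb
      (continuous_abs.rpow_const fun _ => Or.inr hr)
  have hI2 : Integrable (fun x => σ ^ r * (Q * Real.cosh (S x / σ))) μ :=
    integrable_comp_of_abs_le (φ := fun y => σ ^ r * (Q * Real.cosh (y / σ))) hSm hSb (by fun_prop)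
  calc ∫ x, |S x| ^ r ∂μ ≤ ∫ x, σ ^ r * (Q * Real.cosh (S x / σ)) ∂μ := by
        refine integral_mono hI1 hI2 fun x => ?_
        have h1 := hmom (S x / σ)
        rw [abs_div, abs_of_pos hσ0, Real.div_rpow (abs_nonneg _) hσ0.le,
          div_le_iff₀' (by positivity)] at h1
        exact h1
    _ = σ ^ r * (Q * ∫ x, Real.cosh (S x / σ) ∂μ) := by
        rw [integral_const_mul, integral_const_mul]
    _ ≤ σ ^ r * (Q * Real.exp 2⁻¹) := by gcongr
    _ = Q * Real.exp 2⁻¹ * σ ^ r := by ring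

/-- Some choice of signs makes the first moment of a sum of `n` bounded functions at least of the
order `√n`, if the second moments of the functions are bounded below. -/
lemma exists_signs_le_integral_abs {g : ℕ → Ω → ℝ} (hg : ∀ k, Measurable (g k)) {M : ℝ}
    (hM : 0 < M) (hgM : ∀ k x, |g k x| ≤ M) {c : ℝ} (hc : 0 < c)
    (hgc : ∀ k, c ≤ ∫ x, g k x ^ 2 ∂μ) :
    ∃ D : ℝ, 0 < D ∧ ∀ Λ : Finset ℕ, ∃ η : ℕ → ℝ, (∀ k, |η k| = 1) ∧
      D * √Λ.card ≤ ∫ x, |∑ k ∈ Λ, η k * g k x| ∂μ := by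
  -- A truncation level so high that the `cosh` term costs at most half of the second moment `c / M
  -- ^ 2` of `S / σ`; here `48 = 2 · 4!`.
  obtain ⟨l, hl0, hl⟩ : ∃ l : ℝ, 0 < l ∧ 48 * Real.exp 2⁻¹ * M ^ 2 / c * 2 ≤ l ^ 2 := by
    refine ⟨48 * Real.exp 2⁻¹ * M ^ 2 / c * 2 + 1, by positivity, ?_⟩
    have : 0 < 48 * Real.exp 2⁻¹ * M ^ 2 / c * 2 := by positivity
    nlinarith
  -- Below `l`, `y² ≤ l |y|`; above it, `y² ≤ y⁴ / l²`, and `cosh` controls the fourth power.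
  have hpt : ∀ y : ℝ, y ^ 2 - 48 / l ^ 2 * Real.cosh y ≤ l * |y| := by
    intro y
    have h4 := abs_pow_le_factorial_mul_cosh 4 y
    have h4' : |y| ^ 4 / l ^ 2 ≤ 48 / l ^ 2 * Real.cosh y := by
      rw [div_mul_eq_mul_div]
      gcongr
      refine h4.trans_eq ?_
      norm_num [Nat.factorial]
    have : y ^ 2 ≤ l * |y| + |y| ^ 4 / l ^ 2 := by
      rw [← sq_abs y]
      rcases le_total |y| l with h | h
      · have : 0 ≤ |y| ^ 4 / l ^ 2 := by positivity
        nlinarith [abs_nonneg y]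
      · have h1 : |y| ^ 2 ≤ |y| ^ 4 / l ^ 2 := by
          rw [le_div_iff₀ (by positivity)]
          have : l ^ 2 ≤ |y| ^ 2 := by gcongr
          nlinarith [sq_nonneg |y|]
        have : 0 ≤ l * |y| := by positivity
        linarith
    linarith
  refine ⟨c / (2 * M * l), by positivity, fun Λ => ?_⟩
  rcases Λ.eq_empty_or_nonempty with rfl | hne
  · exact ⟨fun _ => 1, by simp, by simp⟩
  have hcard : (0 : ℝ) < Λ.card := by exact_mod_cast hne.card_pos
  set σ := M * √Λ.card with hσ
  have hσ0 : 0 < σ := by positivity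
  have hσ2 : σ ^ 2 = M ^ 2 * Λ.card := by rw [hσ, mul_pow, Real.sq_sqrt hcard.le]
  obtain ⟨η, hη, h⟩ := exists_signs (μ := μ) hg hgM hσ0 (a := (σ ^ 2)⁻¹) Λ (48 / l ^ 2)
    (by positivity)
  refine ⟨η, hη, ?_⟩
  set S : Ω → ℝ := fun x => ∑ k ∈ Λ, η k * g k x with hS
  have hSm : Measurable S := Finset.measurable_fun_sum _ fun k _ => (hg k).const_mul _
  have hSb : ∀ x, |S x| ≤ Λ.card * M := fun x => abs_sum_sign_le hgM hη Λ x
  have hexp : (Λ.card : ℝ) * (M ^ 2 / (2 * σ ^ 2)) = 2⁻¹ := by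
    rw [hσ2]
    field_simp
  rw [hexp] at h
  have hI1 : Integrable (fun x => (σ ^ 2)⁻¹ * S x ^ 2 - 48 / l ^ 2 * Real.cosh (S x / σ)) μ :=
    integrable_comp_of_abs_le (φ := fun y => (σ ^ 2)⁻¹ * y ^ 2 - 48 / l ^ 2 * Real.cosh (y / σ))
      hSm hSb (by fun_prop)
  have hI2 : Integrable (fun x => l / σ * |S x|) μ :=
    integrable_comp_of_abs_le (φ := fun y => l / σ * |y|) hSm hSb (by fun_prop)
  have hup : ∫ x, ((σ ^ 2)⁻¹ * S x ^ 2 - 48 / l ^ 2 * Real.cosh (S x / σ)) ∂μ ≤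
      l / σ * ∫ x, |S x| ∂μ := by
    rw [← integral_const_mul]
    refine integral_mono hI1 hI2 fun x => ?_
    have h1 := hpt (S x / σ)
    rw [abs_div, abs_of_pos hσ0, div_pow] at h1
    calc _ = S x ^ 2 / σ ^ 2 - 48 / l ^ 2 * Real.cosh (S x / σ) := by ring
      _ ≤ _ := h1.trans_eq (by ring)
  have hsq : c * Λ.card ≤ ∑ k ∈ Λ, ∫ x, g k x ^ 2 ∂μ := by
    have := Finset.card_nsmul_le_sum Λ (fun k => ∫ x, g k x ^ 2 ∂μ) c fun k _ => hgc k
    rw [nsmul_eq_mul] at this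
    linarith
  have h1 : c / M ^ 2 ≤ (σ ^ 2)⁻¹ * ∑ k ∈ Λ, ∫ x, g k x ^ 2 ∂μ := by
    have : c / M ^ 2 = (σ ^ 2)⁻¹ * (c * Λ.card) := by
      rw [hσ2]
      field_simp
    rw [this]
    gcongr
  have h2 : 48 / l ^ 2 * Real.exp 2⁻¹ ≤ c / M ^ 2 / 2 := by
    rw [div_mul_eq_mul_div, div_le_iff₀ (by positivity)]
    have := mul_le_mul_of_nonneg_left hl (show 0 ≤ c / M ^ 2 / 2 by positivity)
    refine le_trans (le_of_eq ?_) this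
    field_simp
  have h3 : c / M ^ 2 / 2 ≤ l / σ * ∫ x, |S x| ∂μ := by linarith
  have h4 := mul_le_mul_of_nonneg_left h3 (show 0 ≤ σ / l by positivity)
  calc c / (2 * M * l) * √Λ.card = σ / l * (c / M ^ 2 / 2) := by
        rw [hσ]
        field_simp
    _ ≤ _ := h4
    _ = ∫ x, |S x| ∂μ := by field_simp

end Signs

/-! ### Norms of sums in `L_p` -/

section LpBounds

variable {Ω : Type*} [MeasurableSpace Ω] {μ : Measure Ω} {p : ℝ≥0∞}

lemma coeFn_sum_smul (v : ℕ → Lp ℝ p μ) {g : ℕ → Ω → ℝ} (hg : ∀ k, v k =ᵐ[μ] g k) (η : ℕ → ℝ)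
    (Λ : Finset ℕ) : (∑ k ∈ Λ, η k • v k : Lp ℝ p μ) =ᵐ[μ] fun x => ∑ k ∈ Λ, η k * g k x := by
  classical
  induction Λ using Finset.induction_on with
  | empty =>
    simp only [Finset.sum_empty]
    exact Lp.coeFn_zero ℝ p μ
  | insert i s hi ih =>
    rw [Finset.sum_insert hi]
    filter_upwards [Lp.coeFn_add (η i • v i) (∑ k ∈ s, η k • v k), Lp.coeFn_smul (η i) (v i),
      hg i, ih] with x h1 h2 h3 h4
    rw [h1, Finset.sum_insert hi, Pi.add_apply, h2, h4, Pi.smul_apply, h3, smul_eq_mul]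

/-- Clamping a measurable representative to `[-M, M]` makes the bound hold everywhere, as the sign
selection requires. -/
lemma exists_measurable_bounded_rep (v : Lp ℝ p μ) {M : ℝ} (hM : 0 ≤ M)
    (hv : ∀ᵐ x ∂μ, |v x| ≤ M) :
    ∃ g : Ω → ℝ, Measurable g ∧ (∀ x, |g x| ≤ M) ∧ v =ᵐ[μ] g := by
  have hm := (Lp.aestronglyMeasurable v).aemeasurable
  refine ⟨fun x => max (-M) (min M (hm.mk v x)),
    measurable_const.max (measurable_const.min hm.measurable_mk), fun x => ?_, ?_⟩
  · exact abs_le.2 ⟨le_max_left _ _, max_le (by linarith) (min_le_left _ _)⟩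
  · filter_upwards [hm.ae_eq_mk, hv] with x h1 h2
    rw [← h1, min_eq_right (abs_le.1 h2).2, max_eq_right (abs_le.1 h2).1]

lemma norm_rpow_eq_integral (hp0 : p ≠ 0) (hp : p ≠ ∞) (v : Lp ℝ p μ) {u : Ω → ℝ}
    (h : v =ᵐ[μ] u) : ‖v‖ ^ p.toReal = ∫ x, |u x| ^ p.toReal ∂μ := by
  have hr : 0 < p.toReal := ENNReal.toReal_pos hp0 hp
  have hI : 0 ≤ ∫ x, ‖v x‖ ^ p.toReal ∂μ := integral_nonneg fun x => by positivity
  rw [Lp.norm_def, (Lp.memLp v).eLpNorm_eq_integral_rpow_norm hp0 hp,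
    ENNReal.toReal_ofReal (by positivity), Real.rpow_inv_rpow hI hr.ne']
  refine integral_congr_ae ?_
  filter_upwards [h] with x hx
  rw [hx, Real.norm_eq_abs]

lemma integral_abs_le_norm [IsProbabilityMeasure μ] [Fact (1 ≤ p)] (v : Lp ℝ p μ) {u : Ω → ℝ}
    (h : v =ᵐ[μ] u) : ∫ x, |u x| ∂μ ≤ ‖v‖ := by
  have hv := Lp.memLp v
  have h1 : MemLp v 1 μ := hv.mono_exponent Fact.out
  have e : ∫ x, |u x| ∂μ = (eLpNorm v 1 μ).toReal := by
    rw [h1.eLpNorm_eq_integral_rpow_norm one_ne_zero ENNReal.one_ne_top]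
    simp only [ENNReal.toReal_one, Real.rpow_one, inv_one]
    rw [ENNReal.toReal_ofReal (integral_nonneg fun x => norm_nonneg _)]
    refine integral_congr_ae ?_
    filter_upwards [h] with x hx
    rw [hx, Real.norm_eq_abs]
  rw [e, Lp.norm_def]
  exact ENNReal.toReal_mono hv.eLpNorm_ne_top
    (eLpNorm_le_eLpNorm_of_exponent_le Fact.out hv.aestronglyMeasurable)

/-- A lower bound for the `r`-th moment of a bounded function gives one for the second moment. -/
lemma le_integral_sq [IsProbabilityMeasure μ] {g : Ω → ℝ} (hg : Measurable g) {M : ℝ} (hM : 0 < M)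
    (hgM : ∀ x, |g x| ≤ M) {r c : ℝ} (hr : 1 < r) (hc : 0 < c)
    (h : c ≤ ∫ x, |g x| ^ r ∂μ) : (c / M ^ (r - 1)) ^ 2 ≤ ∫ x, g x ^ 2 ∂μ := by
  set L := c / M ^ (r - 1) with hL
  have hL0 : 0 < L := by positivity
  have h1 : c ≤ M ^ (r - 1) * ∫ x, |g x| ∂μ := by
    rw [← integral_const_mul]
    refine h.trans (integral_mono
      (integrable_comp_of_abs_le (φ := fun y => |y| ^ r) hg hgM
        (continuous_abs.rpow_const fun _ => Or.inr (by linarith)))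
      (integrable_comp_of_abs_le (φ := fun y => M ^ (r - 1) * |y|) hg hgM (by fun_prop))
      fun x => ?_)
    have e : |g x| ^ r = |g x| ^ (r - 1) * |g x| := by
      have := Real.rpow_add_of_nonneg (abs_nonneg (g x)) (show 0 ≤ r - 1 by linarith) zero_le_one
      rwa [sub_add_cancel, Real.rpow_one] at this
    change |g x| ^ r ≤ M ^ (r - 1) * |g x|
    rw [e]
    exact mul_le_mul_of_nonneg_right
      (Real.rpow_le_rpow (abs_nonneg _) (hgM x) (by linarith)) (abs_nonneg _)
  have h2 : L ≤ ∫ x, |g x| ∂μ := by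
    rw [hL, div_le_iff₀' (by positivity)]
    exact h1
  have hIsq : Integrable (fun x => g x ^ 2) μ :=
    integrable_comp_of_abs_le (φ := fun y => y ^ 2) hg hgM (by fun_prop)
  have hIabs : Integrable (fun x => 2 * L * |g x|) μ :=
    integrable_comp_of_abs_le (φ := fun y => 2 * L * |y|) hg hgM (by fun_prop)
  -- The pointwise bound `2 L |g| ≤ L² + g²` stands in for Cauchy–Schwarz.
  have h3 : 2 * L * ∫ x, |g x| ∂μ ≤ L ^ 2 + ∫ x, g x ^ 2 ∂μ := by
    have := integral_mono hIabs ((integrable_const (L ^ 2)).add hIsq) (fun x => by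
      have := sq_nonneg (|g x| - L)
      have := sq_abs (g x)
      simp only [Pi.add_apply]
      nlinarith)
    rw [integral_const_mul] at this
    refine this.trans_eq ?_
    rw [integral_add' (integrable_const _) hIsq]
    simp
  nlinarith

/-- For a semi-normalized uniformly bounded quasi-greedy basis of `L_p`, `1 < p < ∞`, sums of
basis functions with bounded coefficients are at most of the order of the square root of the number
of terms, and this is the order of sums with coefficients equal to one. -/
lemma exists_sum_bounds [IsProbabilityMeasure μ] [Fact (1 ≤ p)] (hp1 : 1 < p) (hp : p < ∞)
    {Ψ : SchauderBasis ℝ (Lp ℝ p μ)} (hnorm : IsSemiNormalized Ψ) {K : ℝ} (hK0 : 0 < K)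
    (hK : ∀ (f : Lp ℝ p μ) (ϱ : ℕ → ℕ), IsDecreasing Ψ f ϱ →
      ∀ m, ‖greedyApproximant Ψ f ϱ m‖ ≤ K * ‖f‖)
    (hub : IsUniformlyBounded Ψ) :
    ∃ b B : ℝ, 0 < b ∧ 0 < B ∧
      (∀ (Λ : Finset ℕ) (c : ℕ → ℝ) (t : ℝ), 0 ≤ t → (∀ k ∈ Λ, |c k| ≤ t) →
        ‖∑ k ∈ Λ, c k • Ψ k‖ ≤ t * (B * √Λ.card)) ∧
      ∀ Λ : Finset ℕ, b * √Λ.card ≤ ‖∑ k ∈ Λ, Ψ k‖ := by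
  obtain ⟨c₀, hc₀, hΨ⟩ := hnorm
  obtain ⟨M, hM, hMb⟩ : ∃ M : ℝ, 0 < M ∧ ∀ k, ∀ᵐ x ∂μ, |(Ψ k : Lp ℝ p μ) x| ≤ M := by
    obtain ⟨M, hMb⟩ := hub
    exact ⟨max M 1, by positivity, fun k => (hMb k).mono fun x hx => hx.trans (le_max_left _ _)⟩
  have hp0 : p ≠ 0 := (zero_lt_one.trans hp1).ne'
  set r := p.toReal with hr
  have hr1 : 1 < r := by
    rw [hr, ← ENNReal.toReal_one]
    exact (ENNReal.toReal_lt_toReal ENNReal.one_ne_top hp.ne).2 hp1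
  have hr0 : 0 < r := by linarith
  choose g hg hgM hgΨ using fun k => exists_measurable_bounded_rep (Ψ k) hM.le (hMb k)
  obtain ⟨D, hD, hupper⟩ := exists_signs_integral_rpow_le (μ := μ) hg hM hgM hr0.le
  obtain ⟨E, hE, hlower⟩ := exists_signs_le_integral_abs (μ := μ) hg hM hgM
    (c := (c₀ ^ r / M ^ (r - 1)) ^ 2) (by positivity) fun k => by
      refine le_integral_sq (hg k) hM (hgM k) hr1 (by positivity) ?_
      rw [← norm_rpow_eq_integral hp0 hp.ne (Ψ k) (hgΨ k)]
      exact Real.rpow_le_rpow hc₀.le (hΨ k).1 hr0.le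
  refine ⟨E / (2 * K), 2 * K * (D ^ r⁻¹ * M), by positivity, by positivity, ?_, ?_⟩
  · intro Λ c t ht hc
    refine norm_sum_le_of_signs Ψ _ Λ (fun η hη => ?_) c ht hc
    obtain ⟨ε, hε, h⟩ := hupper Λ
    rw [← norm_rpow_eq_integral hp0 hp.ne _ (coeFn_sum_smul Ψ hgΨ ε Λ)] at h
    have h1 : ‖∑ k ∈ Λ, ε k • Ψ k‖ ≤ D ^ r⁻¹ * (M * √Λ.card) := by
      refine (Real.rpow_le_rpow_iff (norm_nonneg _) (by positivity) hr0).1 (h.trans_eq ?_)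
      rw [Real.mul_rpow (x := D ^ r⁻¹) (by positivity) (by positivity),
        Real.rpow_inv_rpow hD.le hr0.ne']
    refine (norm_sum_sign_le hK Λ ε η hε hη).trans ?_
    calc _ ≤ 2 * K * (D ^ r⁻¹ * (M * √Λ.card)) := by gcongr
      _ = _ := by ring
  · intro Λ
    obtain ⟨η, hη, h⟩ := hlower Λ
    have h1 := h.trans (integral_abs_le_norm _ (coeFn_sum_smul Ψ hgΨ η Λ))
    have h2 := h1.trans (norm_sum_sign_le hK Λ (fun _ => 1) η (by simp) hη)
    simp only [one_smul] at h2
    rw [div_mul_eq_mul_div, div_le_iff₀' (by positivity)]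
    exact h2

end LpBounds

end TGA

/-! ### Conclusion -/

theorem theorem3p6 {d : ℕ} (Ω : Set (EuclideanSpace ℝ (Fin d))) (hΩ : IsCompact Ω)
    (μ : MeasureTheory.Measure Ω) [MeasureTheory.IsProbabilityMeasure μ]
    (p : ENNReal) [Fact (1 ≤ p)] (hp1 : 1 < p) (hp : p < ⊤)
    (Ψ : SchauderBasis ℝ (MeasureTheory.Lp ℝ p μ))
    (hnorm : TGA.IsSemiNormalized Ψ) (hqg : TGA.IsQuasiGreedy Ψ)
    (hub : TGA.IsUniformlyBounded Ψ) :
    ∃ c C : ℝ, 0 < c ∧ 0 < C ∧ ∀ α ∈ Set.Icc (0 : ℝ) 1, ∀ m : ℕ, 1 ≤ m →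
      (ENNReal.ofReal (c * (m : ℝ) ^ (-(α / 2))) ≤ TGA.gamma Ψ α m ∧
        TGA.gamma Ψ α m ≤ ENNReal.ofReal (C * (m : ℝ) ^ (-(α / 2)))) ∧
      (2 ≤ p →
        ENNReal.ofReal (c * (m : ℝ) ^ (-(α * (1 - 1 / (min p 2).toReal)))) ≤ TGA.gamma Ψ α m ∧
        TGA.gamma Ψ α m ≤
          ENNReal.ofReal (C * (m : ℝ) ^ (-(α * (1 - 1 / (min p 2).toReal))))) := by
  obtain ⟨K, hK0, hK⟩ : ∃ K : ℝ, 0 < K ∧ ∀ (f : MeasureTheory.Lp ℝ p μ) (ϱ : ℕ → ℕ),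
      TGA.IsDecreasing Ψ f ϱ → ∀ m, ‖TGA.greedyApproximant Ψ f ϱ m‖ ≤ K * ‖f‖ := by
    obtain ⟨K, hK⟩ := hqg
    exact ⟨max K 1, by positivity, fun f ϱ hϱ m => (hK f ϱ hϱ m).trans
      (mul_le_mul_of_nonneg_right (le_max_left _ _) (norm_nonneg _))⟩
  obtain ⟨b, B, hb, hB, hupper, hlower⟩ := TGA.exists_sum_bounds hp1 hp hnorm hK0 hK hub
  have hΨ : ∀ k, ‖Ψ k‖ ≤ 1 := by
    obtain ⟨c₀, -, h⟩ := hnorm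
    exact fun k => (h k).2
  have hbounds : ∀ α ∈ Set.Icc (0 : ℝ) 1, ∀ m : ℕ, 1 ≤ m →
      (ENNReal.ofReal (b / (2 * B + 2) * (m : ℝ) ^ (-(α / 2))) ≤ TGA.gamma Ψ α m ∧
        TGA.gamma Ψ α m ≤ ENNReal.ofReal ((K + 1 + B) * (m : ℝ) ^ (-(α / 2)))) := by
    intro α hα m hm
    refine ⟨TGA.le_gamma hΨ hb hB (fun Λ => ?_) hlower hα hm,
      TGA.gamma_le hΨ hupper hB hK0.le hK hα hm⟩
    simpa using hupper Λ (fun _ => 1) 1 zero_le_one (by simp)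
  refine ⟨b / (2 * B + 2), K + 1 + B, by positivity, by positivity, fun α hα m hm =>
    ⟨hbounds α hα m hm, fun h2 => ?_⟩⟩
  -- For `p ≥ 2` one has `p* = 2`, so both exponents coincide.
  have e : α * (1 - 1 / (min p 2).toReal) = α / 2 := by
    rw [min_eq_right h2, ENNReal.toReal_ofNat]
    ring
  rw [e]
  exact hbounds α hα m hm
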